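/- Let $\mathbb{F}_q$ be a finite field with $q$ elements and let $n\ge 1$ be an odd integer prime to $q$. For a polynomial $g$ over $\mathbb{F}_q$ with $g(0)\ne 0$ put $g^*(X)=g(0)^{-1}X^{\deg g}g(1/X)$. For integers $s,s'$ write $s\sim s'$ if $s\equiv q^k s' \pmod n$ for some $k\ge 0$. There is a factorization over $\mathbb{F}_q$ $$X^n-1=\prod_{i=1}^{\sigma} f_i(X)\prod_{j=1}^{\tau} g_j(X)\,g_j^*(X),$$ where $f_1=X-1$, the $f_i$ and $g_j$ are monic irreducible, $f_i^*=f_i$ for all $i$ and $g_j^*\neq g_j$ for all $j$. The following hold for every such factorization. (1) Let $K$ be an extension field of $\mathbb{F}_q$ that contains a primitive $n$-th root of unity $\zeta$. A polynomial $V\in\mathbb{F}_q[X]$ satisfies $V(X)\,V(X^{n-1})\equiv 1 \pmod{X^n-1}$ if and only if all of the following conditions hold: - $V(1)=\pm 1$; - $V(\zeta^s)\,V(\zeta^{-s})=1$ for all $0\le s<n$ with $s\not\sim n-s$; - $V(\zeta^s)^{q^{r/2}+1}=1$ for all $0<s<n$ with $s\sim n-s$, where $r=[\mathbb{F}_q(\zeta^s):\mathbb{F}_q]$.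 For each $s$ in the last condition, $r$ is even and equals $\deg f_i$ for an index $i\ge 2$ with $f_i(\zeta^s)=0$. (2) The degree of $f_i$ is even for $2\le i\le\sigma$. Write $2c_i=\deg f_i$ for $2\le i\le\sigma$ and $d_j=\deg g_j$ for $1\le j\le\tau$. The number of self-dual normal bases of $\mathbb{F}_{q^n}$ over $\mathbb{F}_q$, that is, of ordered bases $(\alpha,\alpha^q,\dots,\alpha^{q^{n-1}})$ with $\mathrm{Tr}_{\mathbb{F}_{q^n}/\mathbb{F}_q}(\alpha^{q^i}\alpha^{q^j})=\delta_{i,j}$ for $0\le i,j\le n-1$ (cyclic shifts are counted as different bases), is $$2^a\prod_{i=2}^{\sigma}(q^{c_i}+1)\prod_{j=1}^{\tau}(q^{d_j}-1),$$ where $a=1$ if $q$ is odd and $a=0$ if $q$ is even. -/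

import Mathlib

open Polynomial

namespace SelfDualNormal

/-- The reciprocal polynomial `X ^ deg g * g (1 / X)` of `g`, divided by the constant `g 0`.
For `g` with `g 0 ≠ 0`, this is the monic polynomial whose roots are the inverses
of the roots of `g`. -/
noncomputable def recip {F : Type*} [Field F] (g : F[X]) : F[X] :=
  C (g.coeff 0)⁻¹ * g.reverse

/-- A factorization `X ^ n - 1 = ∏_{i=1}^σ f i * ∏_{j=1}^τ g j * (g j)^*` over `F` into
monic irreducible factors, where the `f i` are the self-reciprocal factors, with
`f 1 = X - 1`, and the other factors are grouped in pairs of reciprocal polynomials.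
The values of `f` outside `[1, σ]` and of `g` outside `[1, τ]` play no role. -/
structure Decomposition (F : Type*) [Field F] (n : ℕ) where
  σ : ℕ
  τ : ℕ
  f : ℕ → F[X]
  g : ℕ → F[X]
  one_le_σ : 1 ≤ σ
  f_one : f 1 = X - 1
  f_monic : ∀ i ∈ Finset.Icc 1 σ, (f i).Monic
  f_irreducible : ∀ i ∈ Finset.Icc 1 σ, Irreducible (f i)
  f_recip : ∀ i ∈ Finset.Icc 1 σ, recip (f i) = f i
  g_monic : ∀ j ∈ Finset.Icc 1 τ, (g j).Monic
  g_irreducible : ∀ j ∈ Finset.Icc 1 τ, Irreducible (g j)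
  g_recip : ∀ j ∈ Finset.Icc 1 τ, recip (g j) ≠ g j
  prod_eq : (X ^ n - 1 : F[X]) =
    (∏ i ∈ Finset.Icc 1 σ, f i) * ∏ j ∈ Finset.Icc 1 τ, (g j * recip (g j))

/-- The cyclotomic equivalence relation `s ∼ s'`: there is `k` with `s ≡ q ^ k * s'` mod `n`. -/
def CycloEquiv (q n s s' : ℕ) : Prop := ∃ k : ℕ, s ≡ q ^ k * s' [MOD n]

/-- The ordered basis `b` is of the form `(α, α ^ q, …, α ^ (q ^ (n - 1)))`, `q = |F|`. -/
def IsNormalBasis {F E : Type*} [Field F] [Field E] [Algebra F E] {n : ℕ}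
    (b : Module.Basis (Fin n) F E) : Prop :=
  ∃ α : E, ∀ i : Fin n, b i = α ^ (Nat.card F ^ (i : ℕ))

/-- The ordered basis `b` is equal to its dual basis for the trace form. -/
def IsSelfDualBasis {F E : Type*} [Field F] [Field E] [Algebra F E] {n : ℕ}
    (b : Module.Basis (Fin n) F E) : Prop :=
  ∀ i j : Fin n, Algebra.trace F E (b i * b j) = if i = j then 1 else 0

/-- The conditions on the components `V (ζ ^ s)` of `V`, for `0 ≤ s ≤ n - 1`. -/
def ComponentConditions {F K : Type*} [Field F] [Field K] [Algebra F K] (n : ℕ) (ζ : K)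
    (V : F[X]) : Prop :=
  (V.eval 1 = 1 ∨ V.eval 1 = -1) ∧
  (∀ s < n, ¬ CycloEquiv (Nat.card F) n s (n - s) →
    aeval (ζ ^ s) V * aeval (ζ ^ s)⁻¹ V = 1) ∧
  (∀ s < n, s ≠ 0 → CycloEquiv (Nat.card F) n s (n - s) →
    (aeval (ζ ^ s) V) ^
      (Nat.card F ^ (Module.finrank F (IntermediateField.adjoin F {ζ ^ s}) / 2) + 1) = 1)

end SelfDualNormal

/-! As `n` is invertible in `F`, a congruence modulo `X ^ n - 1` can be tested at the `n`-th roots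
of unity `z`, and the equation in (1) becomes `V(z) V(z⁻¹) = 1`. If `z ≠ 1` is conjugate to `z⁻¹`,
inversion acts on the Frobenius orbit of `z` as the element of order two of a cyclic group. So the
orbit length `r` is even and `V(z⁻¹) = V(z) ^ (q ^ (r / 2))` (`even_natDegree_minpoly`,
`dvd_iff_componentConditions`).

For the count, fix a normal basis generated by `β`, with Frobenius `φ`; each `α` is `V(φ) β` for a
unique `V` of degree less than `n`. The form `B_z(x, y) = ∑ Tr(x φ^i y) z^i` satisfies `B_z(V(φ) x,
W(φ) y) = V(z) W(z⁻¹) B_z(x, y)` (`traceSum_aeval`), and `α` generates a self-dual normal basis iff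
`B_z(α, α) = 1` for all `z`. With `u(z) = B_z(β, β)` this reads `V(z) V(z⁻¹) u(z) = 1`. No self-dual
normal basis has to exist beforehand: it suffices that `u` is nowhere zero, inversion-invariant, and
a square at `1` (`exists_norm_equation`). By the Chinese remainder theorem (`values_bijective`) the
solutions are counted one factor at a time: a square equation for `X - 1`, a norm equation for the
other `f i`, and a hyperbola for each pair `g j`, `recip (g j)`. -/

namespace SelfDualNormal

/-! ### Roots of unity, reciprocal polynomials and Frobenius orbits -/

section Roots

variable {F K : Type*} [Field F] [Field K] [Algebra F K]

theorem X_pow_sub_one_dvd_iff {n : ℕ} (hn : 0 < n) {ζ : K} (hζ : IsPrimitiveRoot ζ n) (P : F[X]) :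
    (X ^ n - 1 : F[X]) ∣ P ↔ ∀ z : K, z ^ n = 1 → aeval z P = 0 := by
  constructor
  · rintro ⟨Q, rfl⟩ z hz
    simp [hz]
  · intro h
    rw [← Polynomial.map_dvd_map' (algebraMap F K)]
    have : (X ^ n - 1 : F[X]).map (algebraMap F K) = X ^ n - 1 := by simp
    rw [this, X_pow_sub_one_eq_prod hn hζ]
    refine Finset.prod_dvd_of_coprime ?_ ?_
    · intro a _ b _ hab
      exact Polynomial.pairwise_coprime_X_sub_C Function.injective_id hab
    · intro z hz
      rw [Polynomial.dvd_iff_isRoot, IsRoot.def, eval_map_algebraMap]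
      exact h z ((mem_nthRootsFinset hn 1).1 hz)

theorem eq_minpoly_of_irreducible {h : F[X]} (hm : h.Monic) (hi : Irreducible h) {z : K}
    (hz : aeval z h = 0) : h = minpoly F z :=
  minpoly.eq_of_irreducible_of_monic hi hz hm

theorem natDegree_recip {g : F[X]} (hg : g.coeff 0 ≠ 0) : (recip g).natDegree = g.natDegree := by
  rw [recip, natDegree_C_mul (inv_ne_zero hg), reverse_natDegree,
    natTrailingDegree_eq_zero.2 (Or.inr hg), Nat.sub_zero]

theorem monic_recip {g : F[X]} (hg : g.coeff 0 ≠ 0) : (recip g).Monic := by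
  rw [Monic, recip, leadingCoeff_mul, leadingCoeff_C, reverse_leadingCoeff, trailingCoeff,
    natTrailingDegree_eq_zero.2 (Or.inr hg), inv_mul_cancel₀ hg]

theorem aeval_recip_eq_zero_iff {g : F[X]} (hg : g.coeff 0 ≠ 0) {z : K} (hz : z ≠ 0) :
    aeval z (recip g) = 0 ↔ aeval z⁻¹ g = 0 := by
  let _ : Invertible z⁻¹ := invertibleOfNonzero (inv_ne_zero hz)
  have := eval₂_reverse_eq_zero_iff (algebraMap F K) z⁻¹ g
  rw [invOf_eq_inv, inv_inv] at this
  rw [recip, map_mul, aeval_C, mul_eq_zero, aeval_def, aeval_def, this]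
  simp [hg]

theorem coeff_zero_minpoly_ne_zero {z : K} (hi : IsIntegral F z) (hz : z ≠ 0) :
    (minpoly F z).coeff 0 ≠ 0 :=
  minpoly.coeff_zero_ne_zero hi hz

theorem adjoin_inv_eq (z : K) :
    IntermediateField.adjoin F {z⁻¹} = IntermediateField.adjoin F {z} := by
  apply le_antisymm
  · rw [IntermediateField.adjoin_simple_le_iff]
    exact inv_mem (IntermediateField.mem_adjoin_simple_self F z)
  · rw [IntermediateField.adjoin_simple_le_iff]
    simpa using inv_mem (IntermediateField.mem_adjoin_simple_self F z⁻¹)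

/-- Both sides are monic and vanish at `z⁻¹`; their degrees agree because `z` and `z⁻¹` generate the
same field. -/
theorem recip_minpoly {z : K} (hi : IsIntegral F z) (hz : z ≠ 0) :
    recip (minpoly F z) = minpoly F z⁻¹ := by
  have h0 := coeff_zero_minpoly_ne_zero hi hz
  have hi' : IsIntegral F z⁻¹ := hi.inv
  refine eq_of_monic_of_dvd_of_natDegree_le (minpoly.monic hi') (monic_recip h0)
    (minpoly.dvd _ _ ?_) ?_
  · rw [aeval_recip_eq_zero_iff h0 (inv_ne_zero hz), inv_inv, minpoly.aeval]
  · rw [natDegree_recip h0, ← IntermediateField.adjoin.finrank hi,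
      ← IntermediateField.adjoin.finrank hi', adjoin_inv_eq]

theorem isIntegral_of_pow_eq_one {n : ℕ} (hn : 0 < n) {z : K} (hz : z ^ n = 1) :
    IsIntegral F z :=
  IsIntegral.of_pow hn (hz ▸ isIntegral_one)

theorem ne_zero_of_pow_eq_one {n : ℕ} (hn : 0 < n) {z : K} (hz : z ^ n = 1) : z ≠ 0 := by
  rintro rfl
  simp [hn.ne'] at hz

/-- This is where the oddness of `n` enters: there is no root of unity of order two. -/
theorem eq_one_of_inv_eq {n : ℕ} (hn : Odd n) {z : K} (hz : z ^ n = 1) (h : z⁻¹ = z) : z = 1 := by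
  have h0 := ne_zero_of_pow_eq_one hn.pos hz
  have h2 : z ^ 2 = 1 := by
    rw [sq]
    nth_rewrite 1 [← h]
    exact inv_mul_cancel₀ h0
  obtain ⟨k, rfl⟩ := hn
  rwa [pow_succ, pow_mul, h2, one_pow, one_mul] at hz

variable [Finite F]

theorem aeval_pow_card_pow (V : F[X]) (z : K) (k : ℕ) :
    aeval (z ^ Nat.card F ^ k) V = aeval z V ^ Nat.card F ^ k := by
  have := Fintype.ofFinite F
  induction k with
  | zero => simp
  | succ k ih =>
    rw [pow_succ, pow_mul, pow_mul, ← ih, ← Fintype.card_eq_nat_card]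
    exact Polynomial.aeval_algHom_apply (FiniteField.frobeniusAlgHom F K) _ V

theorem natDegree_minpoly_dvd_iff {z : K} (hi : IsIntegral F z) (m : ℕ) :
    (minpoly F z).natDegree ∣ m ↔ z ^ Nat.card F ^ m = z := by
  rw [(minpoly.irreducible hi).natDegree_dvd_iff_dvd_X_pow_card_pow_sub_X, minpoly.dvd_iff]
  simp [sub_eq_zero]

/-- Reduce `k` modulo the orbit length `r`. Inverting twice is trivial, so `r` divides `2 (k % r) <
2 r`; since `z⁻¹ ≠ z` the residue is nonzero, which forces `2 (k % r) = r`. -/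
theorem even_natDegree_minpoly {n : ℕ} (hn : Odd n) {z : K} (hz : z ^ n = 1) (h1 : z ≠ 1) {k : ℕ}
    (hk : z ^ Nat.card F ^ k = z⁻¹) :
    Even (minpoly F z).natDegree ∧ z ^ Nat.card F ^ ((minpoly F z).natDegree / 2) = z⁻¹ := by
  have hi : IsIntegral F z := isIntegral_of_pow_eq_one hn.pos hz
  set r := (minpoly F z).natDegree with hr
  have hr0 : 0 < r := minpoly.natDegree_pos hi
  have hne : z⁻¹ ≠ z := fun h => h1 (eq_one_of_inv_eq hn hz h)
  have hk' : z ^ Nat.card F ^ (k % r) = z⁻¹ := by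
    rw [← hk]
    conv_rhs => rw [← Nat.div_add_mod k r, pow_add, pow_mul]
    rw [(natDegree_minpoly_dvd_iff hi _).1 (Dvd.intro _ rfl)]
  have hd : r ∣ k % r + k % r := by
    rw [natDegree_minpoly_dvd_iff hi, pow_add, pow_mul, hk', inv_pow, hk', inv_inv]
  have hlt : k % r < r := Nat.mod_lt _ hr0
  have hne0 : k % r ≠ 0 := fun h => hne (by simpa [h] using hk'.symm)
  obtain ⟨c, hc⟩ := hd
  have hc1 : c = 1 := by
    have : c ≠ 0 := by rintro rfl; omega
    have : c < 2 := by
      by_contra! h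
      have := Nat.mul_le_mul_left r h
      omega
    omega
  subst hc1
  refine ⟨⟨k % r, by omega⟩, ?_⟩
  rw [show r / 2 = k % r by omega, hk']

theorem minpoly_inv_eq_of_pow {z : K} (hi : IsIntegral F z) {k : ℕ}
    (hk : z ^ Nat.card F ^ k = z⁻¹) : minpoly F z⁻¹ = minpoly F z := by
  symm
  apply minpoly.eq_of_irreducible_of_monic (minpoly.irreducible hi) _ (minpoly.monic hi)
  rw [← hk, aeval_pow_card_pow, minpoly.aeval, zero_pow (pow_ne_zero _ Nat.card_pos.ne')]

/-- Elements with the same minimal polynomial are Galois conjugate in the finite field `F(z)`, whose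
Galois group consists of powers of Frobenius. -/
theorem exists_pow_eq_inv {z : K} (hi : IsIntegral F z) (h : minpoly F z⁻¹ = minpoly F z) :
    ∃ k, z ^ Nat.card F ^ k = z⁻¹ := by
  have := Fintype.ofFinite F
  let L := IntermediateField.adjoin F {z}
  have : FiniteDimensional F L := IntermediateField.adjoin.finiteDimensional hi
  have : Finite L := Module.finite_of_finite F
  let y : L := IntermediateField.AdjoinSimple.gen F z
  have hy : (y : K) = z := IntermediateField.AdjoinSimple.coe_gen F z
  have hc : IsConjRoot F y y⁻¹ := by
    rw [isConjRoot_def, ← minpoly.algebraMap_eq (algebraMap L K).injective y,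
      ← minpoly.algebraMap_eq (algebraMap L K).injective y⁻¹, map_inv₀]
    change minpoly F (y : K) = minpoly F (y : K)⁻¹
    rw [hy, h]
  obtain ⟨τ, hτ⟩ := isConjRoot_iff_exists_algEquiv.1 hc.symm
  obtain ⟨k, rfl⟩ := (FiniteField.bijective_frobeniusAlgEquivOfAlgebraic_pow F L).2 τ
  refine ⟨k, ?_⟩
  have h2 := congrArg (fun x : L => (x : K)) hτ
  simp only [AlgEquiv.coe_pow, FiniteField.coe_frobeniusAlgEquivOfAlgebraic_iterate] at h2
  rw [Fintype.card_eq_nat_card] at h2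
  simpa [hy] using h2

end Roots

/-! ### Part (1): the component conditions -/

section Components

variable {F K : Type*} [Field F] [Field K] [Algebra F K] {n : ℕ} {ζ : K}

theorem pow_sub_eq_inv (hn : 0 < n) (hζ : ζ ^ n = 1) {s : ℕ} (hs : s < n) :
    ζ ^ (n - s) = (ζ ^ s)⁻¹ := by
  rw [pow_sub₀ _ (ne_zero_of_pow_eq_one hn hζ) hs.le, hζ, one_mul]

theorem cycloEquiv_iff (hn : 0 < n) (hζ : IsPrimitiveRoot ζ n) (q : ℕ) {s : ℕ} (hs : s < n) :
    CycloEquiv q n s (n - s) ↔ ∃ k, (ζ ^ s) ^ q ^ k = (ζ ^ s)⁻¹ := by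
  unfold CycloEquiv
  refine exists_congr fun k => ?_
  have h : s ≡ q ^ k * (n - s) [MOD n] ↔ ζ ^ s = ζ ^ (q ^ k * (n - s)) := by
    rw [(isOfFinOrder_iff_pow_eq_one.2 ⟨n, hn, hζ.pow_eq_one⟩).pow_eq_pow_iff_modEq,
      ← hζ.eq_orderOf]
  rw [h, mul_comm, pow_mul, pow_sub_eq_inv hn hζ.pow_eq_one hs, inv_pow, eq_comm,
    inv_eq_iff_eq_inv]

theorem forall_roots_iff (hn : 0 < n) (hζ : IsPrimitiveRoot ζ n) (p : K → Prop) :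
    (∀ z : K, z ^ n = 1 → p z) ↔ ∀ s < n, p (ζ ^ s) := by
  constructor
  · intro h s _
    exact h _ (by rw [← pow_mul, mul_comm, pow_mul, hζ.pow_eq_one, one_pow])
  · intro h z hz
    have : NeZero n := ⟨hn.ne'⟩
    obtain ⟨s, hs, rfl⟩ := hζ.eq_pow_of_pow_eq_one hz
    exact h s hs

theorem aeval_comp_X_pow_sub_one (hn : 0 < n) {z : K} (hz : z ^ n = 1) (V : F[X]) :
    aeval z (V.comp (X ^ (n - 1))) = aeval z⁻¹ V := by
  have : z ^ (n - 1) = z⁻¹ := by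
    rw [pow_sub₀ z (ne_zero_of_pow_eq_one hn hz) hn, hz, pow_one, one_mul]
  simp [aeval_comp, this]

variable [Finite F]

theorem dvd_iff_componentConditions (hn : Odd n) (hζ : IsPrimitiveRoot ζ n) (V : F[X]) :
    (X ^ n - 1 : F[X]) ∣ V * V.comp (X ^ (n - 1)) - 1 ↔ ComponentConditions n ζ V := by
  have key : ∀ z : K, z ^ n = 1 → aeval z (V * V.comp (X ^ (n - 1)) - 1 : F[X]) =
      aeval z V * aeval z⁻¹ V - 1 := by
    intro z hz
    rw [map_sub, map_mul, aeval_comp_X_pow_sub_one hn.pos hz, map_one]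
  have hroot : ∀ s, (ζ ^ s) ^ n = 1 := fun s => by
    rw [← pow_mul, mul_comm, pow_mul, hζ.pow_eq_one, one_pow]
  rw [X_pow_sub_one_dvd_iff hn.pos hζ, forall_roots_iff hn.pos hζ]
  -- The index `0` satisfies `0 ∼ n - 0` but is excluded from the third condition; there the
  -- equation is `V(1) ^ 2 = 1`.
  have h0 : (aeval (ζ ^ 0) V * aeval (ζ ^ 0)⁻¹ V = 1) ↔ (V.eval 1 = 1 ∨ V.eval 1 = -1) := by
    rw [pow_zero, inv_one, ← map_one (algebraMap F K), aeval_algebraMap_apply_eq_algebraMap_eval,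
      ← map_mul, (algebraMap F K).injective.eq_iff, mul_self_eq_one_iff]
  have hc : ∀ s < n, s ≠ 0 → CycloEquiv (Nat.card F) n s (n - s) →
      aeval (ζ ^ s)⁻¹ V = (aeval (ζ ^ s) V) ^
      (Nat.card F ^ (Module.finrank F (IntermediateField.adjoin F {ζ ^ s}) / 2)) := by
    intro s hs hs0 hcy
    obtain ⟨k, hk⟩ := (cycloEquiv_iff hn.pos hζ _ hs).1 hcy
    have := (even_natDegree_minpoly hn (hroot s)
      (hζ.pow_ne_one_of_pos_of_lt hs0 hs) hk).2
    rw [IntermediateField.adjoin.finrank (isIntegral_of_pow_eq_one hn.pos (hroot s)),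
      ← aeval_pow_card_pow, this]
  unfold ComponentConditions
  constructor
  · intro h
    have h' : ∀ s < n, aeval (ζ ^ s) V * aeval (ζ ^ s)⁻¹ V = 1 := fun s hs => by
      rw [← sub_eq_zero, ← key _ (hroot s), h s hs]
    refine ⟨h0.1 (h' 0 hn.pos), fun s hs _ => h' s hs, fun s hs hs0 hcy => ?_⟩
    rw [pow_succ', ← hc s hs hs0 hcy, h' s hs]
  · rintro ⟨h1, h2, h3⟩ s hs
    rw [key _ (hroot s), sub_eq_zero]
    by_cases hs0 : s = 0
    · subst hs0
      exact h0.2 h1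
    by_cases hcy : CycloEquiv (Nat.card F) n s (n - s)
    · rw [hc s hs hs0 hcy, ← pow_succ']
      exact h3 s hs hs0 hcy
    · exact h2 s hs hcy

variable (D : Decomposition F n)

omit [Finite F] in
theorem Decomposition.coeff_zero_g (hn : 0 < n) {j : ℕ} (hj : j ∈ Finset.Icc 1 D.τ) :
    (D.g j).coeff 0 ≠ 0 := by
  intro h
  have hd : D.g j ∣ (X ^ n - 1 : F[X]) := by
    rw [D.prod_eq]
    exact ((dvd_mul_right (D.g j) (recip (D.g j))).trans
      (Finset.dvd_prod_of_mem (fun j => D.g j * recip (D.g j)) hj)).mul_left _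
  have := (X_dvd_iff.2 h).trans hd
  rw [X_dvd_iff] at this
  simp [coeff_X_pow, coeff_one, hn.ne] at this

omit [Finite F] in
theorem Decomposition.root_cases (hn : 0 < n) {z : K} (hz : z ^ n = 1) :
    (∃ i ∈ Finset.Icc 1 D.σ, aeval z (D.f i) = 0) ∨
      ∃ j ∈ Finset.Icc 1 D.τ, aeval z (D.g j) = 0 ∨ aeval z⁻¹ (D.g j) = 0 := by
  have h : aeval z (X ^ n - 1 : F[X]) = 0 := by simp [hz]
  rw [D.prod_eq, map_mul, mul_eq_zero, map_prod, map_prod, Finset.prod_eq_zero_iff,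
    Finset.prod_eq_zero_iff] at h
  refine h.imp id ?_
  rintro ⟨j, hj, h⟩
  rw [map_mul, mul_eq_zero, aeval_recip_eq_zero_iff (D.coeff_zero_g hn hj)
    (ne_zero_of_pow_eq_one hn hz)] at h
  exact ⟨j, hj, h⟩

/-- A root conjugate to its inverse has a self-reciprocal minimal polynomial, so it cannot come from
a pair `g j`, `recip (g j)`. -/
theorem Decomposition.exists_factor (hn : Odd n) {z : K} (hz : z ^ n = 1) (h1 : z ≠ 1) {k : ℕ}
    (hk : z ^ Nat.card F ^ k = z⁻¹) :
    ∃ i ∈ Finset.Icc 2 D.σ, aeval z (D.f i) = 0 ∧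
      (D.f i).natDegree = (minpoly F z).natDegree := by
  have hi : IsIntegral F z := isIntegral_of_pow_eq_one hn.pos hz
  have h0 := ne_zero_of_pow_eq_one hn.pos hz
  have hinv := minpoly_inv_eq_of_pow hi hk
  rcases D.root_cases hn.pos hz with ⟨i, hiσ, hf⟩ | ⟨j, hj, hg⟩
  · refine ⟨i, ?_, hf, ?_⟩
    · rw [Finset.mem_Icc] at hiσ ⊢
      refine ⟨?_, hiσ.2⟩
      rcases hiσ.1.eq_or_lt with h | h
      · rw [← h, D.f_one] at hf
        simp [sub_eq_zero] at hf
        exact absurd hf h1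
      · exact h
    · rw [eq_minpoly_of_irreducible (D.f_monic i hiσ) (D.f_irreducible i hiσ) hf]
  · exfalso
    apply D.g_recip j hj
    have : D.g j = minpoly F z := by
      rcases hg with hg | hg
      · exact eq_minpoly_of_irreducible (D.g_monic j hj) (D.g_irreducible j hj) hg
      · rw [eq_minpoly_of_irreducible (D.g_monic j hj) (D.g_irreducible j hj) hg, hinv]
    rw [this, recip_minpoly hi h0, hinv]

end Components

/-! ### Existence of the factorization -/

section Existence

theorem prod_Icc_getD {M : Type*} [CommMonoid M] (l : List M) (d : M) :
    ∏ i ∈ Finset.Icc 1 l.length, l.getD (i - 1) d = l.prod := by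
  rw [← Finset.Ico_add_one_right_eq_Icc, Finset.prod_Ico_eq_prod_range]
  simp only [Nat.add_sub_cancel, Nat.add_sub_cancel_left]
  rw [← Fin.prod_univ_eq_prod_range (fun i => l.getD i d), ← Fin.prod_univ_getElem]
  simp

theorem getD_mem_of_mem_Icc {M : Type*} (l : List M) (d : M) {i : ℕ}
    (hi : i ∈ Finset.Icc 1 l.length) : l.getD (i - 1) d ∈ l := by
  rw [Finset.mem_Icc] at hi
  rw [List.getD_eq_getElem _ _ (by omega)]
  exact List.getElem_mem _

/-- The prescribed first element serves to put `X - 1` at index `1`. -/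
theorem exists_enumeration {M N : Type*} [CommMonoid N] (T : Finset M) {a : M} (ha : a ∈ T)
    (φ : M → N) :
    ∃ (k : ℕ) (e : ℕ → M), 1 ≤ k ∧ e 1 = a ∧ (∀ i ∈ Finset.Icc 1 k, e i ∈ T) ∧
      ∏ i ∈ Finset.Icc 1 k, φ (e i) = ∏ h ∈ T, φ h := by
  classical
  let l : List M := a :: (T.erase a).toList
  have hl : ∀ h ∈ l, h ∈ T := by
    intro h hh
    rcases List.mem_cons.1 hh with rfl | hh
    · exact ha
    · exact Finset.mem_of_mem_erase (Finset.mem_toList.1 hh)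
  refine ⟨l.length, fun i => l.getD (i - 1) a, by simp [l], by simp [l],
    fun i hi => hl _ (getD_mem_of_mem_Icc l a hi), ?_⟩
  have h := prod_Icc_getD (l.map φ) (φ a)
  rw [List.length_map] at h
  simp only [List.getD_map] at h
  rw [h, List.map_cons, List.prod_cons, Finset.prod_map_toList, Finset.mul_prod_erase T φ ha]

theorem exists_prod_involution {M : Type*} [CommMonoid M] [DecidableEq M] (S : Finset M)
    (r : M → M) (hr : ∀ h ∈ S, r h ∈ S) (hrr : ∀ h ∈ S, r (r h) = h) :
    ∃ T ⊆ S, (∀ h ∈ T, r h ≠ h) ∧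
      ∏ h ∈ S, h = (∏ h ∈ S with r h = h, h) * ∏ h ∈ T, (h * r h) := by
  classical
  -- An arbitrary linear order selects the smaller element of each two-element orbit of `r`.
  let _ : LinearOrder M := linearOrderOfSTO WellOrderingRel
  refine ⟨S.filter fun h => h < r h, Finset.filter_subset _ _,
    fun h hh => (Finset.mem_filter.1 hh).2.ne', ?_⟩
  rw [← Finset.prod_filter_mul_prod_filter_not S (fun h => r h = h)]
  congr 1
  rw [Finset.prod_mul_distrib, ← Finset.prod_filter_mul_prod_filter_not _ (fun h => h < r h),
    Finset.filter_filter, Finset.filter_filter]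
  congr 1
  · refine Finset.prod_congr (Finset.filter_congr fun h _ => ?_) fun _ _ => rfl
    exact ⟨fun h => h.2, fun h => ⟨h.ne', h⟩⟩
  · symm
    refine Finset.prod_bij' (fun h _ => r h) (fun h _ => r h) ?_ ?_ ?_ ?_ ?_
    · intro h hh
      simp only [Finset.mem_filter] at hh ⊢
      rw [hrr h hh.1]
      exact ⟨hr h hh.1, hh.2.ne, hh.2.not_gt⟩
    · intro h hh
      simp only [Finset.mem_filter] at hh ⊢
      rw [hrr h hh.1]
      exact ⟨hr h hh.1, lt_of_le_of_ne (not_lt.1 hh.2.2) hh.2.1⟩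
    · intro h hh
      exact hrr h (Finset.mem_filter.1 hh).1
    · intro h hh
      exact hrr h (Finset.mem_filter.1 hh).1
    · intro h hh
      rfl

variable (F : Type*) [Field F]

theorem recip_X_sub_one : recip (X - 1 : F[X]) = X - 1 := by
  have h := recip_minpoly (F := F) (K := F) (z := 1) isIntegral_one one_ne_zero
  rwa [inv_one, minpoly.one] at h

theorem exists_decomposition {n : ℕ} (hn : 0 < n) (hF : (n : F) ≠ 0) :
    Nonempty (Decomposition F n) := by
  classical
  have hsep : (X ^ n - 1 : F[X]).Separable := by
    simpa using separable_X_pow_sub_C (1 : F) hF one_ne_zero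
  have hmon : (X ^ n - 1 : F[X]).Monic := by
    simpa using monic_X_pow_sub_C (1 : F) hn.ne'
  let S : Finset F[X] := (UniqueFactorizationMonoid.normalizedFactors (X ^ n - 1 : F[X])).toFinset
  have hmem : ∀ h, h ∈ S ↔ Irreducible h ∧ h.Monic ∧ h ∣ X ^ n - 1 := by
    intro h
    rw [Multiset.mem_toFinset, Polynomial.mem_normalizedFactors_iff hmon.ne_zero]
  have hprod : ∏ h ∈ S, h = X ^ n - 1 := by
    have hnd := (UniqueFactorizationMonoid.squarefree_iff_nodup_normalizedFactors
      hmon.ne_zero).1 hsep.squarefree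
    rw [← hmon.normalize_eq_self,
      ← UniqueFactorizationMonoid.prod_normalizedFactors_eq hmon.ne_zero, Finset.prod,
      Multiset.toFinset_val, hnd.dedup, Multiset.map_id']
  -- Once factors are minimal polynomials of roots of unity, `recip` is inversion of the root, hence
  -- an involution of `S`.
  have hroot : ∀ h ∈ S, ∃ z : AlgebraicClosure F, z ^ n = 1 ∧ h = minpoly F z := by
    intro h hh
    obtain ⟨hi, hm, hd⟩ := (hmem h).1 hh
    obtain ⟨z, hz⟩ := IsAlgClosed.exists_aeval_eq_zero (AlgebraicClosure F) h
      (degree_pos_of_irreducible hi).ne'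
    refine ⟨z, ?_, eq_minpoly_of_irreducible hm hi hz⟩
    obtain ⟨Q, hQ⟩ := hd
    have := congrArg (aeval z) hQ
    simpa [hz, sub_eq_zero] using this
  have hrecip : ∀ h ∈ S, recip h ∈ S ∧ recip (recip h) = h := by
    intro h hh
    obtain ⟨z, hz, rfl⟩ := hroot h hh
    have hi : IsIntegral F z := isIntegral_of_pow_eq_one hn hz
    have h0 := ne_zero_of_pow_eq_one hn hz
    rw [recip_minpoly hi h0, recip_minpoly hi.inv (inv_ne_zero h0), inv_inv, hmem]
    refine ⟨⟨minpoly.irreducible hi.inv, minpoly.monic hi.inv, minpoly.dvd _ _ ?_⟩, rfl⟩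
    simp [hz]
  have hX : (X - 1 : F[X]) ∈ S := by
    rw [hmem]
    refine ⟨by simpa using irreducible_X_sub_C (1 : F), by simpa using monic_X_sub_C (1 : F), ?_⟩
    simpa using sub_dvd_pow_sub_pow (X : F[X]) 1 n
  obtain ⟨T, hTS, hT, hST⟩ := exists_prod_involution S recip (fun h hh => (hrecip h hh).1)
    (fun h hh => (hrecip h hh).2)
  obtain ⟨σ, f, hσ, hf1, hf, hfp⟩ := exists_enumeration (S.filter fun h => recip h = h)
    (Finset.mem_filter.2 ⟨hX, recip_X_sub_one F⟩) (fun h => h)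
  obtain ⟨τ, g, hg, hgp⟩ : ∃ (τ : ℕ) (g : ℕ → F[X]), (∀ j ∈ Finset.Icc 1 τ, g j ∈ T) ∧
      ∏ j ∈ Finset.Icc 1 τ, (g j * recip (g j)) = ∏ h ∈ T, (h * recip h) := by
    rcases T.eq_empty_or_nonempty with rfl | ⟨a, ha⟩
    · exact ⟨0, 0, by simp, by simp⟩
    · obtain ⟨τ, g, -, -, hg, hgp⟩ := exists_enumeration T ha (fun h => h * recip h)
      exact ⟨τ, g, hg, hgp⟩
  have hf' := fun i hi => (hmem _).1 (Finset.mem_filter.1 (hf i hi)).1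
  have hg' := fun j hj => (hmem _).1 (hTS (hg j hj))
  exact ⟨{ σ, τ, f, g, one_le_σ := hσ, f_one := hf1
           f_monic := fun i hi => (hf' i hi).2.1
           f_irreducible := fun i hi => (hf' i hi).1
           f_recip := fun i hi => (Finset.mem_filter.1 (hf i hi)).2
           g_monic := fun j hj => (hg' j hj).2.1
           g_irreducible := fun j hj => (hg' j hj).1
           g_recip := fun j hj => hT _ (hg j hj)
           prod_eq := by rw [← hprod, hST, hfp, hgp] }⟩

end Existence

/-! ### Local equations over finite fields -/

section LocalCounts

variable {L : Type*} [Field L] [Finite L]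

/-- Here `x ^ (Q + 1)` is the norm to the subfield of `Q` elements, which contains `a`. The count
holds because `X ^ (Q + 1) - a⁻¹` is separable and divides `X ^ (Q ^ 2) - X`, so all its roots lie
in `L`. -/
theorem card_norm_eq {Q : ℕ} (hQ : Nat.card L = Q ^ 2) {a : L} (ha : a ≠ 0) (haQ : a ^ Q = a) :
    Nat.card {x : L // x ^ (Q + 1) * a = 1} = Q + 1 := by
  have := Fintype.ofFinite L
  have hcard : Fintype.card L = Q ^ 2 := by rw [Fintype.card_eq_nat_card, hQ]
  have hQ1 : 1 < Q := by
    have : 1 < Q ^ 2 := hcard ▸ Fintype.one_lt_card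
    by_contra! h
    interval_cases Q <;> omega
  have hQ0 : (Q : L) = 0 := by
    have h := FiniteField.cast_card_eq_zero L
    rw [hcard, Nat.cast_pow] at h
    exact pow_eq_zero_iff two_ne_zero |>.1 h
  have haQ' : (a⁻¹) ^ (Q - 1) = 1 := by
    rw [inv_pow, inv_eq_one]
    apply mul_right_cancel₀ ha
    rw [← pow_succ, Nat.sub_add_cancel hQ1.le, haQ, one_mul]
  have hdvd : (X ^ (Q + 1) - C a⁻¹ : L[X]) ∣ X ^ Fintype.card L - X := by
    have h1 := sub_dvd_pow_sub_pow (X ^ (Q + 1) : L[X]) (C a⁻¹) (Q - 1)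
    rw [← C_pow, haQ', C_1, ← pow_mul] at h1
    refine h1.trans ⟨X, ?_⟩
    have h2 : (Q + 1) * (Q - 1) + 1 = Q ^ 2 := by
      obtain ⟨m, rfl⟩ : ∃ m, Q = m + 1 := ⟨Q - 1, by omega⟩
      simp only [Nat.add_sub_cancel]
      ring
    rw [hcard, sub_mul, one_mul, ← pow_succ, h2]
  have hspl : (X ^ (Q + 1) - C a⁻¹ : L[X]).Splits := by
    refine Splits.of_dvd ?_ (FiniteField.X_pow_card_sub_X_ne_zero L Fintype.one_lt_card) hdvd
    rw [splits_iff_card_roots, FiniteField.roots_X_pow_card_sub_X,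
      FiniteField.X_pow_card_sub_X_natDegree_eq L Fintype.one_lt_card]
    rfl
  have hsep : (X ^ (Q + 1) - C a⁻¹ : L[X]).Separable :=
    separable_X_pow_sub_C _ (by simp [hQ0]) (inv_ne_zero ha)
  have h := card_rootSet_eq_natDegree (K := L) hsep (by simpa using hspl)
  rw [natDegree_X_pow_sub_C, ← Nat.card_eq_fintype_card] at h
  refine (Nat.card_congr (Equiv.subtypeEquivRight fun x => ?_)).trans h
  rw [mem_rootSet_of_ne (X_pow_sub_C_ne_zero (Nat.succ_pos _) _)]
  simp [sub_eq_zero, mul_eq_one_iff_eq_inv₀ ha]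

omit [Finite L] in
theorem card_mul_eq {a : L} (ha : a ≠ 0) :
    Nat.card {y : L × L // y.1 * y.2 * a = 1} = Nat.card L - 1 := by
  rw [← Nat.card_units]
  refine Nat.card_congr
    { toFun := fun y => Units.mk0 y.1.1 ?_
      invFun := fun x => ⟨(x, (x : L)⁻¹ * a⁻¹), ?_⟩
      left_inv := ?_
      right_inv := ?_ }
  · intro h
    simpa [h] using y.2
  · have := x.ne_zero
    field_simp
  · rintro ⟨⟨y₁, y₂⟩, h⟩
    have h1 : y₁ ≠ 0 := by
      rintro rfl
      simp at h
    simp only [Units.val_mk0, Subtype.mk.injEq, Prod.mk.injEq, true_and]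
    rw [← mul_inv]
    exact (eq_inv_of_mul_eq_one_right (by rw [← h]; ring)).symm
  · intro x
    ext
    simp

/-- If `a = b ^ 2`, the solutions are `b⁻¹` and `-b⁻¹`, which coincide exactly in characteristic
two. -/
theorem card_sq_eq {a : L} (ha : a ≠ 0) (hsq : IsSquare a) :
    Nat.card {x : L // x ^ 2 * a = 1} = 2 ^ (if Even (Nat.card L) then 0 else 1) := by
  have := Fintype.ofFinite L
  obtain ⟨b, rfl⟩ := hsq
  have hb : b ≠ 0 := by
    rintro rfl
    simp at ha
  have h : ∀ x : L, x ^ 2 * (b * b) = 1 ↔ x ∈ ({b⁻¹, -b⁻¹} : Set L) := by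
    intro x
    rw [← sq, ← mul_pow, sq_eq_one_iff, mul_eq_one_iff_eq_inv₀ hb,
      ← neg_eq_iff_eq_neg, ← neg_mul, mul_eq_one_iff_eq_inv₀ hb, neg_eq_iff_eq_neg]
    rfl
  rw [Nat.card_congr (Equiv.subtypeEquivRight h)]
  change Set.ncard _ = _
  have hev : Even (Nat.card L) ↔ ringChar L = 2 := by
    rw [FiniteField.even_card_iff_char_two, ← Nat.even_iff, Fintype.card_eq_nat_card]
  split_ifs with hE
  · have := ringChar.of_eq (hev.1 hE)
    rw [CharTwo.neg_eq, Set.pair_eq_singleton, Set.ncard_singleton, pow_zero]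
  · rw [Set.ncard_pair, pow_one]
    intro h
    have := (Ring.eq_self_iff_eq_zero_of_char_ne_two (fun h => hE (hev.2 h))).1 h.symm
    exact inv_ne_zero hb this

end LocalCounts

/-! ### Properties of the factors -/

section Factors

variable {F K : Type*} [Field F] [Field K] [Algebra F K] {n : ℕ} (D : Decomposition F n)

theorem Decomposition.f_dvd {i : ℕ} (hi : i ∈ Finset.Icc 1 D.σ) : D.f i ∣ X ^ n - 1 := by
  rw [D.prod_eq]
  exact (Finset.dvd_prod_of_mem _ hi).mul_right _

theorem Decomposition.g_dvd {j : ℕ} (hj : j ∈ Finset.Icc 1 D.τ) : D.g j ∣ X ^ n - 1 := by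
  rw [D.prod_eq]
  exact ((dvd_mul_right (D.g j) (recip (D.g j))).trans
    (Finset.dvd_prod_of_mem (fun j => D.g j * recip (D.g j)) hj)).mul_left _

theorem pow_eq_one_of_dvd {h : F[X]} (hd : h ∣ X ^ n - 1) {z : K} (hz : aeval z h = 0) :
    z ^ n = 1 := by
  obtain ⟨Q, hQ⟩ := hd
  have := congrArg (aeval z) hQ
  simpa [hz, sub_eq_zero] using this

theorem Decomposition.f_ne_X_sub_one (hF : (n : F) ≠ 0) {i : ℕ} (hi : i ∈ Finset.Icc 2 D.σ) :
    D.f i ≠ X - 1 := by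
  intro h
  rw [Finset.mem_Icc] at hi
  have hsep : (X ^ n - 1 : F[X]).Separable := by
    simpa using separable_X_pow_sub_C (1 : F) hF one_ne_zero
  have hd : (X - 1 : F[X]) * (X - 1) ∣ X ^ n - 1 := by
    have h12 : ∏ k ∈ ({1, i} : Finset ℕ), D.f k = (X - 1) * (X - 1) := by
      rw [Finset.prod_pair (by omega), D.f_one, h]
    rw [← h12, D.prod_eq]
    refine (Finset.prod_dvd_prod_of_subset _ _ _ ?_).mul_right _
    intro k hk
    rw [Finset.mem_insert, Finset.mem_singleton] at hk
    rw [Finset.mem_Icc]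
    omega
  have hu := hsep.squarefree _ hd
  have hirr : Irreducible (X - 1 : F[X]) := by simpa using irreducible_X_sub_C (1 : F)
  exact hirr.not_isUnit hu

theorem Decomposition.sum_natDegree (hn : 0 < n) :
    ∑ i ∈ Finset.Icc 1 D.σ, (D.f i).natDegree + ∑ j ∈ Finset.Icc 1 D.τ, 2 * (D.g j).natDegree
      = n := by
  have h : (X ^ n - 1 : F[X]).natDegree = n := by simpa using natDegree_X_pow_sub_C (R := F) (r := 1)
  rw [D.prod_eq] at h
  have hgm : ∀ j ∈ Finset.Icc 1 D.τ, (D.g j * recip (D.g j)).Monic := fun j hj =>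
    (D.g_monic j hj).mul (monic_recip (D.coeff_zero_g hn hj))
  rw [(monic_prod_of_monic _ _ D.f_monic).natDegree_mul (monic_prod_of_monic _ _ hgm),
    natDegree_prod_of_monic _ _ D.f_monic, natDegree_prod_of_monic _ _ hgm] at h
  refine Eq.trans ?_ h
  congr 1
  refine Finset.sum_congr rfl fun j hj => ?_
  rw [(D.g_monic j hj).natDegree_mul (monic_recip (D.coeff_zero_g hn hj)),
    natDegree_recip (D.coeff_zero_g hn hj), two_mul]

theorem Decomposition.f_eq_minpoly {i : ℕ} (hi : i ∈ Finset.Icc 1 D.σ) {z : K}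
    (hz : aeval z (D.f i) = 0) : D.f i = minpoly F z :=
  eq_minpoly_of_irreducible (D.f_monic i hi) (D.f_irreducible i hi) hz

theorem Decomposition.g_eq_minpoly {j : ℕ} (hj : j ∈ Finset.Icc 1 D.τ) {z : K}
    (hz : aeval z (D.g j) = 0) : D.g j = minpoly F z :=
  eq_minpoly_of_irreducible (D.g_monic j hj) (D.g_irreducible j hj) hz

/-- A polynomial identity on the `n`-th roots of unity can be checked at one root of each factor,
provided that it is invariant under inversion. -/
theorem Decomposition.forall_roots_of_forall_factors (hn : 0 < n) {P : F[X]}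
    (hP : ∀ z : K, z ^ n = 1 → aeval z P = 0 → aeval z⁻¹ P = 0)
    {ρ : Finset.Icc 1 D.σ → K} (hρ : ∀ i, aeval (ρ i) (D.f i) = 0)
    {η : Finset.Icc 1 D.τ → K} (hη : ∀ j, aeval (η j) (D.g j) = 0)
    (h1 : ∀ i, aeval (ρ i) P = 0) (h2 : ∀ j, aeval (η j) P = 0) {z : K} (hz : z ^ n = 1) :
    aeval z P = 0 := by
  have hz' : z⁻¹ ^ n = 1 := by rw [inv_pow, hz, inv_one]
  rcases D.root_cases hn hz with ⟨i, hi, hf⟩ | ⟨j, hj, hg⟩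
  · have : D.f i ∣ P := by
      rw [D.f_eq_minpoly hi (hρ ⟨i, hi⟩)]
      exact minpoly.dvd _ _ (h1 ⟨i, hi⟩)
    exact aeval_eq_zero_of_dvd_aeval_eq_zero this hf
  · have : D.g j ∣ P := by
      rw [D.g_eq_minpoly hj (hη ⟨j, hj⟩)]
      exact minpoly.dvd _ _ (h2 ⟨j, hj⟩)
    rcases hg with hg | hg
    · exact aeval_eq_zero_of_dvd_aeval_eq_zero this hg
    · simpa using hP _ hz' (aeval_eq_zero_of_dvd_aeval_eq_zero this hg)

variable [Finite F]

theorem Decomposition.exists_frobenius_eq_inv (hn : 0 < n) {i : ℕ} (hi : i ∈ Finset.Icc 1 D.σ)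
    {z : K} (hz : aeval z (D.f i) = 0) : ∃ k, z ^ Nat.card F ^ k = z⁻¹ := by
  have hzn : z ^ n = 1 := pow_eq_one_of_dvd (D.f_dvd hi) hz
  have hint : IsIntegral F z := isIntegral_of_pow_eq_one hn hzn
  apply exists_pow_eq_inv hint
  rw [← recip_minpoly hint (ne_zero_of_pow_eq_one hn hzn), ← D.f_eq_minpoly hi hz, D.f_recip i hi]

theorem Decomposition.frobenius_half_eq_inv (hn : Odd n) {i : ℕ} (hi : i ∈ Finset.Icc 1 D.σ)
    {z : K} (hz : aeval z (D.f i) = 0) :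
    z ^ Nat.card F ^ ((D.f i).natDegree / 2) = z⁻¹ := by
  obtain ⟨k, hk⟩ := D.exists_frobenius_eq_inv hn.pos hi hz
  -- The factor `X - 1` has odd degree, but every power of `1` is its own inverse.
  by_cases h1 : z = 1
  · simp [h1]
  · rw [D.f_eq_minpoly hi hz]
    exact (even_natDegree_minpoly hn (pow_eq_one_of_dvd (D.f_dvd hi) hz) h1 hk).2

theorem Decomposition.even_natDegree (hn : Odd n) (hF : (n : F) ≠ 0) {i : ℕ}
    (hi : i ∈ Finset.Icc 2 D.σ) : Even (D.f i).natDegree := by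
  have hi1 : i ∈ Finset.Icc 1 D.σ := Finset.Icc_subset_Icc_left (by norm_num) hi
  obtain ⟨z, hz⟩ := IsAlgClosed.exists_aeval_eq_zero (AlgebraicClosure F) (D.f i)
    (degree_pos_of_irreducible (D.f_irreducible i hi1)).ne'
  obtain ⟨k, hk⟩ := D.exists_frobenius_eq_inv hn.pos hi1 hz
  have hf := D.f_eq_minpoly hi1 hz
  rw [hf]
  refine (even_natDegree_minpoly hn (pow_eq_one_of_dvd (D.f_dvd hi1) hz) ?_ hk).1
  rintro rfl
  rw [minpoly.one] at hf
  exact D.f_ne_X_sub_one hF hi hf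

end Factors

/-! ### Counting solutions of the twisted norm equation -/

section Count

open IntermediateField

variable {F K : Type*} [Field F] [Field K] [Algebra F K] {n : ℕ}
  (D : Decomposition F n)

theorem eq_zero_of_forall_roots {ζ : K} (hn : 0 < n) (hζ : IsPrimitiveRoot ζ n) {V : F[X]}
    (hV : V ∈ degreeLT F n) (h : ∀ z : K, z ^ n = 1 → aeval z V = 0) : V = 0 := by
  refine eq_zero_of_dvd_of_degree_lt ((X_pow_sub_one_dvd_iff hn hζ V).2 h) ?_
  have : (X ^ n - 1 : F[X]).degree = n := by simpa using degree_X_pow_sub_C hn (1 : F)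
  rw [this]
  exact mem_degreeLT.1 hV

theorem natCard_adjoin {z : K} (hi : IsIntegral F z) :
    Nat.card F⟮z⟯ = Nat.card F ^ (minpoly F z).natDegree := by
  have := adjoin.finiteDimensional hi
  rw [Module.natCard_eq_pow_finrank (K := F), adjoin.finrank hi]

/-- The values of a polynomial at chosen roots of the factors `f i`, and at chosen roots of
the factors `g j` and their inverses. -/
noncomputable def Decomposition.values (ρ : Finset.Icc 1 D.σ → K) (η : Finset.Icc 1 D.τ → K)
    (V : degreeLT F n) : (∀ i, F⟮ρ i⟯) × ∀ j, F⟮η j⟯ × F⟮η j⟯ :=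
  (fun i => aeval (AdjoinSimple.gen F (ρ i)) (V : F[X]),
    fun j => (aeval (AdjoinSimple.gen F (η j)) (V : F[X]),
      aeval (AdjoinSimple.gen F (η j))⁻¹ (V : F[X])))

theorem coe_aeval_gen (z : K) (V : F[X]) :
    ((aeval (AdjoinSimple.gen F z) V : F⟮z⟯) : K) = aeval z V := by
  rw [← AdjoinSimple.coe_gen F z]
  exact (aeval_algebraMap_apply K (AdjoinSimple.gen F z) V).symm

theorem coe_aeval_gen_inv (z : K) (V : F[X]) :
    ((aeval (AdjoinSimple.gen F z)⁻¹ V : F⟮z⟯) : K) = aeval z⁻¹ V := by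
  have h := (aeval_algebraMap_apply K (AdjoinSimple.gen F z)⁻¹ V).symm
  rw [map_inv₀] at h
  rwa [IntermediateField.algebraMap_apply, IntermediateField.algebraMap_apply,
    AdjoinSimple.coe_gen F z] at h

/-- The Chinese remainder theorem, proved by counting: a polynomial of degree less than `n` with all
these values zero vanishes at every `n`-th root of unity, and both sides have `q ^ n` elements by
`sum_natDegree`. -/
theorem Decomposition.values_bijective [Finite F] {ζ : K} (hn : 0 < n) (hζ : IsPrimitiveRoot ζ n)
    {ρ : Finset.Icc 1 D.σ → K} (hρ : ∀ i, aeval (ρ i) (D.f i) = 0)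
    {η : Finset.Icc 1 D.τ → K} (hη : ∀ j, aeval (η j) (D.g j) = 0) :
    Function.Bijective (D.values ρ η) := by
  have hρi : ∀ i, IsIntegral F (ρ i) := fun i =>
    isIntegral_of_pow_eq_one hn (pow_eq_one_of_dvd (D.f_dvd i.2) (hρ i))
  have hηi : ∀ j, IsIntegral F (η j) := fun j =>
    isIntegral_of_pow_eq_one hn (pow_eq_one_of_dvd (D.g_dvd j.2) (hη j))
  have : ∀ i, FiniteDimensional F F⟮ρ i⟯ := fun i => adjoin.finiteDimensional (hρi i)
  have : ∀ j, FiniteDimensional F F⟮η j⟯ := fun j => adjoin.finiteDimensional (hηi j)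
  have : ∀ i, Finite F⟮ρ i⟯ := fun i => Module.finite_of_finite F
  have : ∀ j, Finite F⟮η j⟯ := fun j => Module.finite_of_finite F
  refine Function.Injective.bijective_of_nat_card_le ?_ ?_
  · intro V W hVW
    rw [← sub_eq_zero, ← Subtype.coe_inj]
    refine eq_zero_of_forall_roots hn hζ (V - W).2 fun z hz => ?_
    have h1 : ∀ i, aeval (ρ i) ((V : F[X]) - (W : F[X])) = 0 := fun i => by
      have := congrFun (congrArg Prod.fst hVW) i
      rw [map_sub, ← coe_aeval_gen (ρ i) (V : F[X]), ← coe_aeval_gen (ρ i) (W : F[X]), sub_eq_zero]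
      exact congrArg _ this
    have h2 : ∀ j, aeval (η j) ((V : F[X]) - (W : F[X])) = 0 := fun j => by
      have := congrArg Prod.fst (congrFun (congrArg Prod.snd hVW) j)
      rw [map_sub, ← coe_aeval_gen (η j) (V : F[X]), ← coe_aeval_gen (η j) (W : F[X]), sub_eq_zero]
      exact congrArg _ this
    have h3 : ∀ j, aeval (η j)⁻¹ ((V : F[X]) - (W : F[X])) = 0 := fun j => by
      have := congrArg Prod.snd (congrFun (congrArg Prod.snd hVW) j)
      rw [map_sub, ← coe_aeval_gen_inv (η j) (V : F[X]), ← coe_aeval_gen_inv (η j) (W : F[X]), sub_eq_zero]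
      exact congrArg _ this
    change aeval z ((V : F[X]) - (W : F[X])) = 0
    rcases D.root_cases hn hz with ⟨i, hi, hf⟩ | ⟨j, hj, hg⟩
    · refine aeval_eq_zero_of_dvd_aeval_eq_zero ?_ hf
      rw [D.f_eq_minpoly hi (hρ ⟨i, hi⟩)]
      exact minpoly.dvd _ _ (h1 ⟨i, hi⟩)
    · have h0 := ne_zero_of_pow_eq_one hn (pow_eq_one_of_dvd (D.g_dvd hj) (hη ⟨j, hj⟩))
      rcases hg with hg | hg
      · refine aeval_eq_zero_of_dvd_aeval_eq_zero ?_ hg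
        rw [D.g_eq_minpoly hj (hη ⟨j, hj⟩)]
        exact minpoly.dvd _ _ (h2 ⟨j, hj⟩)
      -- Here `z` is a root of `recip (g j)`, hence conjugate to the inverse of the chosen root of
      -- `g j`.
      · have hr : minpoly F z = minpoly F (η ⟨j, hj⟩)⁻¹ := by
          rw [← recip_minpoly (hηi ⟨j, hj⟩) h0, ← D.g_eq_minpoly hj (hη ⟨j, hj⟩),
            D.g_eq_minpoly hj hg, recip_minpoly, inv_inv]
          · exact (isIntegral_of_pow_eq_one hn hz).inv
          · exact inv_ne_zero (ne_zero_of_pow_eq_one hn hz)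
        refine aeval_eq_zero_of_dvd_aeval_eq_zero ?_ (minpoly.aeval F z)
        rw [hr]
        exact minpoly.dvd _ _ (h3 ⟨j, hj⟩)
  · rw [Nat.card_congr (degreeLTEquiv F n).toEquiv, Nat.card_fun, Nat.card_prod, Nat.card_pi,
      Nat.card_pi, Nat.card_fin]
    simp only [Nat.card_prod, natCard_adjoin (hρi _), natCard_adjoin (hηi _), ← pow_add, ← two_mul,
      Finset.prod_pow_eq_pow_sum]
    apply le_of_eq
    congr 1
    conv_rhs => rw [← D.sum_natDegree hn]
    congr 1
    · rw [← Finset.sum_coe_sort (Finset.Icc 1 D.σ)]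
      exact Finset.sum_congr rfl fun i _ => by rw [D.f_eq_minpoly i.2 (hρ i)]
    · rw [← Finset.sum_coe_sort (Finset.Icc 1 D.τ)]
      exact Finset.sum_congr rfl fun j _ => by rw [D.g_eq_minpoly j.2 (hη j)]

theorem natCard_subtype_forall {ι : Type*} [Fintype ι] {A : ι → Type*} (p : ∀ i, A i → Prop) :
    Nat.card {x : ∀ i, A i // ∀ i, p i (x i)} = ∏ i, Nat.card {a : A i // p i a} := by
  rw [← Nat.card_pi]
  exact Nat.card_congr
    { toFun := fun x i => ⟨x.1 i, x.2 i⟩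
      invFun := fun x => ⟨fun i => (x i).1, fun i => (x i).2⟩ }

/-- The twist `u` does not change the count: its values are units, lie in the fixed field of
inversion at the self-reciprocal factors, and are squares at `1`. -/
theorem Decomposition.card_solutions [Finite F] [IsAlgClosed K] {ζ : K} (hn : Odd n)
    (hF : (n : F) ≠ 0) (hζ : IsPrimitiveRoot ζ n) (u : F[X])
    (hu0 : ∀ z : K, z ^ n = 1 → aeval z u ≠ 0)
    (hsymm : ∀ z : K, z ^ n = 1 → aeval z⁻¹ u = aeval z u) (hsq : IsSquare (u.eval 1)) :
    Nat.card {V : degreeLT F n // ∀ z : K, z ^ n = 1 →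
        aeval z (V : F[X]) * aeval z⁻¹ (V : F[X]) * aeval z u = 1} =
      2 ^ (if Even (Nat.card F) then 0 else 1) *
        (∏ i ∈ Finset.Icc 2 D.σ, (Nat.card F ^ ((D.f i).natDegree / 2) + 1)) *
        ∏ j ∈ Finset.Icc 1 D.τ, (Nat.card F ^ (D.g j).natDegree - 1) := by
  have hroot : ∀ h : F[X], Irreducible h → ∃ z : K, aeval z h = 0 := fun h hh =>
    IsAlgClosed.exists_aeval_eq_zero K h (degree_pos_of_irreducible hh).ne'
  choose ρ hρ using fun i : Finset.Icc 1 D.σ => hroot _ (D.f_irreducible i i.2)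
  choose η hη using fun j : Finset.Icc 1 D.τ => hroot _ (D.g_irreducible j j.2)
  have hρn : ∀ i, ρ i ^ n = 1 := fun i => pow_eq_one_of_dvd (D.f_dvd i.2) (hρ i)
  have hηn : ∀ j, η j ^ n = 1 := fun j => pow_eq_one_of_dvd (D.g_dvd j.2) (hη j)
  have hρi : ∀ i, IsIntegral F (ρ i) := fun i => isIntegral_of_pow_eq_one hn.pos (hρn i)
  have hηi : ∀ j, IsIntegral F (η j) := fun j => isIntegral_of_pow_eq_one hn.pos (hηn j)
  have : ∀ i, FiniteDimensional F F⟮ρ i⟯ := fun i => adjoin.finiteDimensional (hρi i)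
  have : ∀ j, FiniteDimensional F F⟮η j⟯ := fun j => adjoin.finiteDimensional (hηi j)
  have : ∀ i, Finite F⟮ρ i⟯ := fun i => Module.finite_of_finite F
  have : ∀ j, Finite F⟮η j⟯ := fun j => Module.finite_of_finite F
  let p : ∀ i, F⟮ρ i⟯ → Prop := fun i x => x ^ (Nat.card F ^ ((D.f i).natDegree / 2) + 1) *
    aeval (AdjoinSimple.gen F (ρ i)) u = 1
  let r : ∀ j, F⟮η j⟯ × F⟮η j⟯ → Prop := fun j y => y.1 * y.2 *
    aeval (AdjoinSimple.gen F (η j)) u = 1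
  have hiff : ∀ V : degreeLT F n, (∀ z : K, z ^ n = 1 →
      aeval z (V : F[X]) * aeval z⁻¹ (V : F[X]) * aeval z u = 1) ↔
      (∀ i, p i ((D.values ρ η V).1 i)) ∧ ∀ j, r j ((D.values ρ η V).2 j) := by
    intro V
    have hfrob : ∀ i, aeval (ρ i)⁻¹ (V : F[X]) =
        aeval (ρ i) (V : F[X]) ^ Nat.card F ^ ((D.f i).natDegree / 2) :=
      fun i => by rw [← D.frobenius_half_eq_inv hn i.2 (hρ i), aeval_pow_card_pow]
    have hp : ∀ i, p i ((D.values ρ η V).1 i) ↔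
        aeval (ρ i) (V : F[X]) * aeval (ρ i)⁻¹ (V : F[X]) * aeval (ρ i) u = 1 := by
      intro i
      rw [hfrob, ← pow_succ', ← coe_aeval_gen (ρ i) (V : F[X]), ← coe_aeval_gen (ρ i) u]
      exact (algebraMap F⟮ρ i⟯ K).injective.eq_iff.symm
    have hr : ∀ j, r j ((D.values ρ η V).2 j) ↔
        aeval (η j) (V : F[X]) * aeval (η j)⁻¹ (V : F[X]) * aeval (η j) u = 1 := by
      intro j
      rw [← coe_aeval_gen (η j) (V : F[X]), ← coe_aeval_gen_inv (η j) (V : F[X]), ← coe_aeval_gen (η j) u]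
      exact (algebraMap F⟮η j⟯ K).injective.eq_iff.symm
    -- Writing the equation as the vanishing of one polynomial over `F` lets it pass from a chosen
    -- root to all its conjugates.
    have hP : ∀ z : K, z ^ n = 1 → (aeval z ((V : F[X]) * (V : F[X]).comp (X ^ (n - 1)) * u - 1) = 0
        ↔ aeval z (V : F[X]) * aeval z⁻¹ (V : F[X]) * aeval z u = 1) := by
      intro z hz
      rw [map_sub, map_mul, map_mul, aeval_comp_X_pow_sub_one hn.pos hz, map_one, sub_eq_zero]
    constructor
    · exact fun h => ⟨fun i => (hp i).2 (h _ (hρn i)), fun j => (hr j).2 (h _ (hηn j))⟩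
    · rintro ⟨h1, h2⟩ z hz
      rw [← hP z hz]
      refine D.forall_roots_of_forall_factors hn.pos (fun y hy h => ?_) hρ hη
        (fun i => (hP _ (hρn i)).2 ((hp i).1 (h1 i)))
        (fun j => (hP _ (hηn j)).2 ((hr j).1 (h2 j))) hz
      rw [hP y hy] at h
      rw [hP _ (by rw [inv_pow, hy, inv_one]), inv_inv, hsymm y hy, mul_comm (aeval y⁻¹ _), h]
  have hcardρ : ∀ i, Nat.card F⟮ρ i⟯ = Nat.card F ^ (D.f i).natDegree := fun i => by
    rw [natCard_adjoin (hρi i), ← D.f_eq_minpoly i.2 (hρ i)]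
  have hcardη : ∀ j, Nat.card F⟮η j⟯ = Nat.card F ^ (D.g j).natDegree := fun j => by
    rw [natCard_adjoin (hηi j), ← D.g_eq_minpoly j.2 (hη j)]
  have hu0ρ : ∀ i, aeval (AdjoinSimple.gen F (ρ i)) u ≠ 0 := fun i h =>
    hu0 _ (hρn i) (by rw [← coe_aeval_gen, h, ZeroMemClass.coe_zero])
  have hu0η : ∀ j, aeval (AdjoinSimple.gen F (η j)) u ≠ 0 := fun j h =>
    hu0 _ (hηn j) (by rw [← coe_aeval_gen, h, ZeroMemClass.coe_zero])
  rw [Nat.card_congr ((Equiv.ofBijective _ (D.values_bijective hn.pos hζ hρ hη)).subtypeEquiv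
    (q := fun x => (∀ i, p i (x.1 i)) ∧ ∀ j, r j (x.2 j)) hiff),
    Nat.card_congr (Equiv.subtypeProdEquivProd (p := fun x : ∀ i, F⟮ρ i⟯ => ∀ i, p i (x i))
      (q := fun y : ∀ j, F⟮η j⟯ × F⟮η j⟯ => ∀ j, r j (y j))), Nat.card_prod, natCard_subtype_forall,
    natCard_subtype_forall]
  have hIcc : Finset.Icc 1 D.σ = insert 1 (Finset.Icc 2 D.σ) :=
    (Finset.insert_Icc_add_one_left_eq_Icc D.one_le_σ).symm
  congr 1
  · have h1 : ∀ i : Finset.Icc 1 D.σ, Nat.card {x // p i x} = if (i : ℕ) = 1 then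
        2 ^ (if Even (Nat.card F) then 0 else 1) else
        Nat.card F ^ ((D.f i).natDegree / 2) + 1 := by
      intro i
      by_cases hi1 : (i : ℕ) = 1
      · have hf : D.f i = X - 1 := by rw [hi1, D.f_one]
        have hdeg : (D.f i).natDegree = 1 := by simpa [hf] using natDegree_X_sub_C (1 : F)
        have hρ1 : ρ i = 1 := by
          have h := hρ i
          rw [hf] at h
          simpa [sub_eq_zero] using h
        have hgen : AdjoinSimple.gen F (ρ i) = algebraMap F _ 1 := by
          ext
          rw [AdjoinSimple.coe_gen, hρ1, map_one, OneMemClass.coe_one]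
        have hc : Nat.card F⟮ρ i⟯ = Nat.card F := by rw [hcardρ, hdeg, pow_one]
        have h2 := card_sq_eq (hu0ρ i) (by
          rw [hgen, aeval_algebraMap_apply_eq_algebraMap_eval]
          exact hsq.map (algebraMap F F⟮ρ i⟯))
        rw [hc] at h2
        rw [if_pos hi1, ← h2]
        -- Since `1 / 2 = 0` in `ℕ`, the exponent `q ^ (1 / 2) + 1` is `2`.
        simp only [p, hdeg]
        rfl
      · have hi2 : (i : ℕ) ∈ Finset.Icc 2 D.σ := by
          have := Finset.mem_Icc.1 i.2
          exact Finset.mem_Icc.2 ⟨by omega, this.2⟩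
        rw [if_neg hi1]
        refine card_norm_eq ?_ (hu0ρ i) ?_
        · rw [hcardρ, ← pow_mul, Nat.div_mul_cancel (D.even_natDegree hn hF hi2).two_dvd]
        -- The half-orbit Frobenius sends `u(ρ)` to `u(ρ⁻¹)`, which is `u(ρ)` by symmetry.
        · apply (algebraMap F⟮ρ i⟯ K).injective
          rw [map_pow]
          change ((aeval (AdjoinSimple.gen F (ρ i)) u : F⟮ρ i⟯) : K) ^ _ =
            ((aeval (AdjoinSimple.gen F (ρ i)) u : F⟮ρ i⟯) : K)
          rw [coe_aeval_gen, ← aeval_pow_card_pow, D.frobenius_half_eq_inv hn i.2 (hρ i),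
            hsymm _ (hρn i)]
    rw [Finset.prod_congr rfl fun i _ => h1 i, Finset.prod_coe_sort (Finset.Icc 1 D.σ) fun i =>
      if i = 1 then 2 ^ (if Even (Nat.card F) then 0 else 1) else
        Nat.card F ^ ((D.f i).natDegree / 2) + 1, hIcc, Finset.prod_insert (by simp), if_pos rfl]
    congr 1
    refine Finset.prod_congr rfl fun i hi => if_neg ?_
    rw [Finset.mem_Icc] at hi
    omega
  · rw [← Finset.prod_coe_sort (Finset.Icc 1 D.τ)]
    refine Finset.prod_congr rfl fun j _ => ?_
    rw [← hcardη j]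
    exact card_mul_eq (hu0η j)

end Count

/-! ### The generating function of the trace form -/

section TraceForm

theorem sum_range_shift {M : Type*} [AddCommGroup M] (g : ℕ → M) {n : ℕ} (h : g n = g 0) :
    ∑ i ∈ Finset.range n, g (i + 1) = ∑ i ∈ Finset.range n, g i := by
  have h1 := Finset.sum_range_succ' g n
  rw [Finset.sum_range_succ, h] at h1
  exact (add_right_cancel h1).symm

theorem map_aeval_apply {F K M : Type*} [Field F] [Field K] [Algebra F K] [AddCommGroup M]
    [Module F M] (f : Module.End F M) (T : M →ₗ[F] K) {z : K} (h : ∀ x, T (f x) = z * T x)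
    (V : F[X]) (x : M) : T (aeval f V x) = aeval z V * T x := by
  induction V using Polynomial.induction_on' with
  | add p q hp hq => simp [hp, hq, add_mul]
  | monomial k a =>
    have hk : ∀ k, T ((f ^ k) x) = z ^ k * T x := by
      intro k
      induction k with
      | zero => simp
      | succ k ih => rw [pow_succ', Module.End.mul_apply, h, ih, pow_succ', mul_assoc]
    simp [aeval_monomial, hk, Algebra.smul_def, mul_assoc]

variable {F : Type*} (K : Type*) {E : Type*} [Field F] [Field K] [Field E] [Algebra F K]
  [Algebra F E]

/-- The generating function `∑ i < n, Tr (x * φ ^ i y) * z ^ i` of the values of the trace form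
on the orbit of `y`. -/
noncomputable def traceSum (φ : Gal(E/F)) (n : ℕ) (z : K) : E →ₗ[F] E →ₗ[F] K :=
  LinearMap.mk₂ F
    (fun x y => ∑ i ∈ Finset.range n, algebraMap F K (Algebra.trace F E (x * (φ ^ i) y)) * z ^ i)
    (fun x x' y => by simp [add_mul, Finset.sum_add_distrib])
    (fun a x y => by simp [Finset.mul_sum, Algebra.smul_def (A := K), mul_assoc])
    (fun x y y' => by simp [mul_add, add_mul, Finset.sum_add_distrib])
    (fun a x y => by simp [Finset.mul_sum, Algebra.smul_def (A := K), mul_assoc])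

variable {K} {φ : Gal(E/F)} {n : ℕ} {z : K}

theorem traceSum_apply (x y : E) : traceSum K φ n z x y =
    ∑ i ∈ Finset.range n, algebraMap F K (Algebra.trace F E (x * (φ ^ i) y)) * z ^ i := rfl

theorem trace_map_mul (σ : Gal(E/F)) (x y : E) :
    Algebra.trace F E (σ x * σ y) = Algebra.trace F E (x * y) := by
  rw [← map_mul, Algebra.trace_eq_of_algEquiv]

variable (hφ : φ ^ n = 1) (hz : z ^ n = 1)
include hφ hz

/-- Shift the summation index by one; the summand is `n`-periodic because `φ ^ n = 1` and `z ^ n =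
1`. -/
theorem mul_traceSum_right (x y : E) :
    z * traceSum K φ n z x (φ y) = traceSum K φ n z x y := by
  rw [traceSum_apply, traceSum_apply, Finset.mul_sum]
  refine Eq.trans (Finset.sum_congr rfl fun i _ => ?_) (sum_range_shift _ (by rw [hφ, hz]; simp))
  rw [pow_succ φ, AlgEquiv.mul_apply, pow_succ z]
  ring

/-- `φ` is an isometry of the trace form, so moving it between the arguments reduces to the index
shift. -/
theorem traceSum_left (x y : E) :
    traceSum K φ n z (φ x) y = z * traceSum K φ n z x y := by
  rw [← mul_traceSum_right hφ hz (φ x) y]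
  congr 1
  rw [traceSum_apply, traceSum_apply]
  refine Finset.sum_congr rfl fun i _ => ?_
  rw [← AlgEquiv.mul_apply, ← pow_succ, pow_succ', AlgEquiv.mul_apply, trace_map_mul]

theorem traceSum_right (hn : 0 < n) (x y : E) :
    traceSum K φ n z x (φ y) = z⁻¹ * traceSum K φ n z x y := by
  rw [← mul_traceSum_right hφ hz x y, inv_mul_cancel_left₀ (ne_zero_of_pow_eq_one hn hz)]

theorem traceSum_symm (hn : 0 < n) (x y : E) :
    traceSum K φ n z x y = traceSum K φ n z⁻¹ y x := by
  -- The shift and the reflection together substitute `n - i` for `i`.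
  rw [traceSum_apply, traceSum_apply, ← sum_range_shift _ (by rw [hφ, hz]; simp),
    ← Finset.sum_range_reflect]
  refine Finset.sum_congr rfl fun i hi => ?_
  rw [Finset.mem_range] at hi
  rw [show n - 1 - i + 1 = n - i by omega, ← trace_map_mul (φ ^ i), ← AlgEquiv.mul_apply,
    ← pow_add, Nat.add_sub_cancel' hi.le, hφ, AlgEquiv.one_apply, mul_comm,
    pow_sub₀ z (ne_zero_of_pow_eq_one hn hz) hi.le, hz, one_mul, inv_pow, mul_comm ((φ ^ i) x)]
  ring

theorem traceSum_aeval (hn : 0 < n) (V W : F[X]) (x y : E) :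
    traceSum K φ n z (aeval (φ.toLinearMap : Module.End F E) V x)
      (aeval (φ.toLinearMap : Module.End F E) W y) =
    aeval z V * aeval z⁻¹ W * traceSum K φ n z x y := by
  have h1 := map_aeval_apply (φ.toLinearMap : Module.End F E)
    ((traceSum K φ n z).flip (aeval (φ.toLinearMap : Module.End F E) W y))
    (fun x => traceSum_left hφ hz x _) V x
  have h2 := map_aeval_apply (φ.toLinearMap : Module.End F E) (traceSum K φ n z x)
    (fun y => traceSum_right hφ hz hn x y) W y
  rw [LinearMap.flip_apply, LinearMap.flip_apply] at h1
  rw [h1, h2, mul_assoc]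

omit hφ hz in
-- A polynomial of degree less than `n` equal to `1` at all `n`-th roots of unity is `1`, which
-- gives the traces `Tr(α φ^i α)`. Invariance of the trace reduces all other pairs to these.
theorem forall_traceSum_eq_one_iff {ζ : K} (hn : 0 < n) (hζ : IsPrimitiveRoot ζ n) (α : E) :
    (∀ z : K, z ^ n = 1 → traceSum K φ n z α α = 1) ↔
    ∀ i j : Fin n, Algebra.trace F E ((φ ^ (i : ℕ)) α * (φ ^ (j : ℕ)) α) = if i = j then 1 else 0 := by
  constructor
  · intro h
    let p : F[X] := ∑ i ∈ Finset.range n, C (Algebra.trace F E (α * (φ ^ i) α)) * X ^ i - 1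
    have hmon : ∀ (a : F) (i : ℕ), i < n → C a * X ^ i ∈ degreeLT F n := fun a i hi =>
      mem_degreeLT.2 ((degree_C_mul_X_pow_le i a).trans_lt (by exact_mod_cast hi))
    have hp : p ∈ degreeLT F n := by
      refine Submodule.sub_mem _ (Submodule.sum_mem _ fun i hi => hmon _ i (Finset.mem_range.1 hi)) ?_
      simpa using hmon 1 0 hn
    have hp0 : p = 0 := by
      refine eq_zero_of_forall_roots hn hζ hp fun z hz => ?_
      have := h z hz
      rw [traceSum_apply] at this
      simp [p, this, -AlgEquiv.coe_pow]
    have hc : ∀ i < n, Algebra.trace F E (α * (φ ^ i) α) = if i = 0 then 1 else 0 := by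
      intro i hi
      have h1 : p.coeff i = 0 := by rw [hp0, coeff_zero]
      simpa [p, finsetSum_coeff, coeff_C_mul, coeff_X_pow, coeff_one, hi, sub_eq_zero] using h1
    have hle : ∀ i j : ℕ, i ≤ j → j < n →
        Algebra.trace F E ((φ ^ i) α * (φ ^ j) α) = if i = j then 1 else 0 := by
      intro i j hij hj
      have h1 : (φ ^ j) α = (φ ^ i) ((φ ^ (j - i)) α) := by
        rw [← AlgEquiv.mul_apply, ← pow_add, Nat.add_sub_cancel' hij]
      rw [h1, trace_map_mul, hc _ (by omega)]
      exact if_congr (by omega) rfl rfl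
    intro i j
    rcases le_total (i : ℕ) j with hij | hij
    · rw [hle _ _ hij j.2]
      exact if_congr Fin.ext_iff.symm rfl rfl
    · rw [mul_comm, hle _ _ hij i.2]
      exact if_congr (by rw [Fin.ext_iff, eq_comm]) rfl rfl
  · intro h z _
    rw [traceSum_apply, Finset.sum_eq_single_of_mem 0 (Finset.mem_range.2 hn)]
    · have := h ⟨0, hn⟩ ⟨0, hn⟩
      simp only [pow_zero, AlgEquiv.one_apply, if_true] at this
      simp [this]
    · intro i hi hi0
      have := h ⟨0, hn⟩ ⟨i, Finset.mem_range.1 hi⟩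
      simp only [pow_zero, AlgEquiv.one_apply, Fin.mk.injEq, hi0.symm, if_false] at this
      simp [this, -AlgEquiv.coe_pow]

end TraceForm

/-! ### Normal bases and the reduction to an equation for `V` -/

section NormalBases

variable (F : Type*) (K : Type*) {E : Type*} [Field F] [Field K] [Field E] [Algebra F K]
  [Algebra F E] {n : ℕ}

theorem frobenius_pow_apply [Algebra.IsAlgebraic F E] [Fintype F] (i : ℕ) (x : E) :
    (FiniteField.frobeniusAlgEquivOfAlgebraic F E ^ i) x = x ^ Nat.card F ^ i := by
  rw [AlgEquiv.coe_pow, FiniteField.coe_frobeniusAlgEquivOfAlgebraic_iterate,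
    Fintype.card_eq_nat_card]

theorem exists_basis_frobenius [Finite E] [Fintype F] (hE : Module.finrank F E = n) :
    ∃ (β : E) (b : Module.Basis (Fin n) F E),
      ∀ i, b i = (FiniteField.frobeniusAlgEquivOfAlgebraic F E ^ (i : ℕ)) β := by
  subst hE
  refine ⟨IsGalois.normalBasis F E 1, (IsGalois.normalBasis F E).reindex (Equiv.ofBijective _
    (FiniteField.bijective_frobeniusAlgEquivOfAlgebraic_pow F E)).symm, fun i => ?_⟩
  rw [Module.Basis.reindex_apply, Equiv.symm_symm, Equiv.ofBijective_apply,
    IsGalois.normalBasis_apply]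

variable {F}

/-- The coefficients of `V` are the coordinates of `V(φ) β` in the basis `b`. -/
theorem aeval_basis_bijective {φ : Gal(E/F)} {β : E} (b : Module.Basis (Fin n) F E)
    (hb : ∀ i, b i = (φ ^ (i : ℕ)) β) :
    Function.Bijective fun V : degreeLT F n =>
      aeval (φ.toLinearMap : Module.End F E) (V : F[X]) β := by
  have h : (fun V : degreeLT F n => aeval (φ.toLinearMap : Module.End F E) (V : F[X]) β) =
      (degreeLTEquiv F n).trans b.equivFun.symm := by
    ext V
    have hpow : ∀ i : ℕ, ((φ.toLinearMap : Module.End F E) ^ i) β = (φ ^ i) β := fun i => by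
      rw [Module.End.pow_apply, AlgEquiv.coe_pow]
      rfl
    have hV : (V : F[X]) = ∑ i : Fin n, C ((V : F[X]).coeff i) * X ^ (i : ℕ) := by
      rw [Fin.sum_univ_eq_sum_range (fun i => C ((V : F[X]).coeff i) * X ^ i)]
      ext k
      by_cases hk : k < n
      · simp [finsetSum_coeff, coeff_X_pow, hk]
      · have : (V : F[X]).coeff k = 0 := coeff_eq_zero_of_degree_lt
          ((mem_degreeLT.1 V.2).trans_le (by exact_mod_cast not_lt.1 hk))
        simp [finsetSum_coeff, coeff_X_pow, hk, this]
    rw [LinearEquiv.trans_apply, Module.Basis.equivFun_symm_apply]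
    conv_lhs => rw [hV]
    rw [map_sum, LinearMap.sum_apply]
    refine Finset.sum_congr rfl fun i _ => ?_
    rw [hb, map_mul, aeval_C, map_pow, aeval_X, Module.End.mul_apply, hpow,
      Module.algebraMap_end_apply]
    rfl
  rw [h]
  exact LinearEquiv.bijective _

theorem linearIndependent_of_trace {v : Fin n → E}
    (h : ∀ i j, Algebra.trace F E (v i * v j) = if i = j then 1 else 0) :
    LinearIndependent F v := by
  rw [Fintype.linearIndependent_iff]
  intro c hc j
  have h1 := congrArg (fun x => Algebra.trace F E (x * v j)) hc
  simpa [Finset.sum_mul, h] using h1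

/-- A normal basis is determined by its first vector; conversely, orthonormal conjugates are
independent and number `n`, so they form a basis. -/
theorem card_selfDualNormalBases [Fintype F] [Algebra.IsAlgebraic F E] (hn : 0 < n)
    (hE : Module.finrank F E = n) :
    Nat.card {b : Module.Basis (Fin n) F E // IsNormalBasis b ∧ IsSelfDualBasis b} =
      Nat.card {α : E // ∀ i j : Fin n, Algebra.trace F E
        ((FiniteField.frobeniusAlgEquivOfAlgebraic F E ^ (i : ℕ)) α *
          (FiniteField.frobeniusAlgEquivOfAlgebraic F E ^ (j : ℕ)) α) = if i = j then 1 else 0} := by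
  have hb0 : ∀ b : Module.Basis (Fin n) F E, IsNormalBasis b →
      ∀ i : Fin n, b i = (FiniteField.frobeniusAlgEquivOfAlgebraic F E ^ (i : ℕ)) (b ⟨0, hn⟩) := by
    rintro b ⟨α, hα⟩ i
    rw [hα i, hα ⟨0, hn⟩, frobenius_pow_apply, pow_zero, pow_one]
  refine Nat.card_congr (Equiv.ofBijective (fun b => ⟨b.1 ⟨0, hn⟩, fun i j => ?_⟩) ⟨?_, ?_⟩)
  · rw [← hb0 _ b.2.1, ← hb0 _ b.2.1]
    exact b.2.2 i j
  · rintro ⟨b, hb, _⟩ ⟨b', hb', _⟩ h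
    simp only [Subtype.mk.injEq] at h ⊢
    refine Module.Basis.eq_of_apply_eq fun i => ?_
    rw [hb0 b hb, hb0 b' hb', h]
  · rintro ⟨α, hα⟩
    have : Nonempty (Fin n) := ⟨⟨0, hn⟩⟩
    let b := basisOfLinearIndependentOfCardEqFinrank (linearIndependent_of_trace hα)
      (by rw [Fintype.card_fin, hE])
    have hb : ∀ i, b i = (FiniteField.frobeniusAlgEquivOfAlgebraic F E ^ (i : ℕ)) α := fun i => by
      simp [b, -AlgEquiv.coe_pow]
    refine ⟨⟨b, ⟨α, fun i => by rw [hb, frobenius_pow_apply]⟩, fun i j => ?_⟩, ?_⟩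
    · rw [hb, hb, hα]
    · simp only [Subtype.mk.injEq]
      rw [hb, pow_zero, AlgEquiv.one_apply]

theorem exists_norm_equation [Finite F] {ζ : K} (hn : 0 < n) (hζ : IsPrimitiveRoot ζ n)
    (hE : Module.finrank F E = n) :
    ∃ u : F[X], (∀ z : K, z ^ n = 1 → aeval z u ≠ 0) ∧
      (∀ z : K, z ^ n = 1 → aeval z⁻¹ u = aeval z u) ∧ IsSquare (u.eval 1) ∧
      Nat.card {b : Module.Basis (Fin n) F E // IsNormalBasis b ∧ IsSelfDualBasis b} =
        Nat.card {V : degreeLT F n // ∀ z : K, z ^ n = 1 →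
          aeval z (V : F[X]) * aeval z⁻¹ (V : F[X]) * aeval z u = 1} := by
  have := Fintype.ofFinite F
  have : FiniteDimensional F E := Module.finite_of_finrank_pos (hE ▸ hn)
  have : Finite E := Module.finite_of_finite F
  let φ := FiniteField.frobeniusAlgEquivOfAlgebraic F E
  have hφ : φ ^ n = 1 := by
    rw [← hE, ← FiniteField.orderOf_frobeniusAlgEquivOfAlgebraic, pow_orderOf_eq_one]
  obtain ⟨β, b, hb⟩ := exists_basis_frobenius F hE
  let u : F[X] := ∑ i ∈ Finset.range n, C (Algebra.trace F E (β * (φ ^ i) β)) * X ^ i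
  have hu : ∀ z : K, aeval z u = traceSum K φ n z β β := fun z => by
    rw [traceSum_apply]
    simp [u, -AlgEquiv.coe_pow]
  have hbij := aeval_basis_bijective b hb
  refine ⟨u, fun z hz => ?_, fun z hz => ?_, ⟨Algebra.trace F E β, ?_⟩, ?_⟩
  -- The vector `α` dual to `β` has `B_z(α, β) = 1`. Writing `α = V(φ) β` gives `V(z) u(z) = 1`, so
  -- `u(z) ≠ 0`.
  · let α := (Algebra.traceForm F E).dualBasis (traceForm_nondegenerate F E) b ⟨0, hn⟩
    have hα : ∀ i : Fin n, Algebra.trace F E (α * b i) = if i = ⟨0, hn⟩ then 1 else 0 := fun i =>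
      LinearMap.BilinForm.apply_dualBasis_left (B := Algebra.traceForm F E)
        (traceForm_nondegenerate F E) b ⟨0, hn⟩ i
    obtain ⟨V, hV⟩ := hbij.2 α
    have h1 : traceSum K φ n z α β = 1 := by
      rw [traceSum_apply, Finset.sum_eq_single_of_mem 0 (Finset.mem_range.2 hn)]
      · have := hα ⟨0, hn⟩
        rw [hb] at this
        simp only [pow_zero, if_true] at this ⊢
        rw [this, map_one, mul_one]
      · intro i hi hi0
        have := hα ⟨i, Finset.mem_range.1 hi⟩
        rw [hb] at this
        simp only [Fin.mk.injEq, hi0, if_false] at this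
        rw [this, map_zero, zero_mul]
    intro h0
    have h2 := traceSum_aeval hφ hz hn (V : F[X]) 1 β β
    rw [← hu, h0, mul_zero, map_one, Module.End.one_apply] at h2
    rw [← hV] at h1
    exact one_ne_zero (h1.symm.trans h2)
  · rw [hu, hu, traceSum_symm hφ hz hn]
  -- The conjugates of `β` sum to its trace, so `u(1) = Tr(β) ^ 2`.
  · have h1 : u.eval 1 = Algebra.trace F E (β * ∑ i ∈ Finset.range n, (φ ^ i) β) := by
      rw [Finset.mul_sum, map_sum]
      simp [u, eval_finsetSum, -AlgEquiv.coe_pow]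
    have h2 : ∑ i ∈ Finset.range n, (φ ^ i) β = algebraMap F E (Algebra.trace F E β) := by
      rw [FiniteField.algebraMap_trace_eq_sum_pow, hE]
      exact Finset.sum_congr rfl fun i _ => frobenius_pow_apply F i β
    rw [h1, h2, mul_comm, ← Algebra.smul_def, map_smul, smul_eq_mul]
  · rw [card_selfDualNormalBases hn hE]
    symm
    refine Nat.card_congr ((Equiv.ofBijective _ hbij).subtypeEquiv fun V => ?_)
    rw [← forall_traceSum_eq_one_iff hn hζ]
    refine forall_congr' fun z => forall_congr' fun hz => ?_
    rw [Equiv.ofBijective_apply, traceSum_aeval hφ hz hn, hu]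

end NormalBases

end SelfDualNormal

/-! ### The main theorem -/

theorem mainTheorem3 (F : Type*) [Field F] [Finite F] (n : ℕ) (hn : Odd n)
    (hnq : n.Coprime (Nat.card F)) :
    -- solutions of `V(X) V(X ^ (n - 1)) = 1` modulo `X ^ n - 1`
    (∀ (K : Type*) [Field K] [Algebra F K] (ζ : K), IsPrimitiveRoot ζ n →
      (∀ V : F[X], (X ^ n - 1 : F[X]) ∣ V * V.comp (X ^ (n - 1)) - 1 ↔
        SelfDualNormal.ComponentConditions n ζ V) ∧
      -- `r = [F(ζ ^ s) : F]` is even, and is the degree of the factor that vanishes at `ζ ^ s`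
      (∀ D : SelfDualNormal.Decomposition F n, ∀ s < n, s ≠ 0 →
        SelfDualNormal.CycloEquiv (Nat.card F) n s (n - s) →
        Even (Module.finrank F (IntermediateField.adjoin F {ζ ^ s})) ∧
        ∃ i ∈ Finset.Icc 2 D.σ, aeval (ζ ^ s) (D.f i) = 0 ∧
          (D.f i).natDegree = Module.finrank F (IntermediateField.adjoin F {ζ ^ s}))) ∧
    -- the number of self-dual normal bases
    Nonempty (SelfDualNormal.Decomposition F n) ∧
    (∀ D : SelfDualNormal.Decomposition F n,
      ∃ c d : ℕ → ℕ,
        (∀ i ∈ Finset.Icc 2 D.σ, 2 * c i = (D.f i).natDegree) ∧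
        (∀ j ∈ Finset.Icc 1 D.τ, d j = (D.g j).natDegree) ∧
        ∀ (E : Type*) [Field E] [Algebra F E], Module.finrank F E = n →
          Nat.card {b : Module.Basis (Fin n) F E //
              SelfDualNormal.IsNormalBasis b ∧ SelfDualNormal.IsSelfDualBasis b} =
            2 ^ (if Even (Nat.card F) then 0 else 1) *
              (∏ i ∈ Finset.Icc 2 D.σ, (Nat.card F ^ c i + 1)) *
              ∏ j ∈ Finset.Icc 1 D.τ, (Nat.card F ^ d j - 1)) := by
  have hF : (n : F) ≠ 0 := by
    have := Fintype.ofFinite F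
    obtain ⟨p, _, m, hp, hcard⟩ := FiniteField.card' F
    rw [← Nat.card_eq_fintype_card] at hcard
    rw [Ne, CharP.cast_eq_zero_iff F p]
    intro hpn
    have hpq : p ∣ Nat.card F := hcard ▸ dvd_pow_self p m.ne_zero
    exact hp.one_lt.ne' (Nat.dvd_one.1 (hnq ▸ Nat.dvd_gcd hpn hpq))
  refine ⟨fun K _ _ ζ hζ => ⟨SelfDualNormal.dvd_iff_componentConditions hn hζ, ?_⟩,
    SelfDualNormal.exists_decomposition F hn.pos hF, fun D => ?_⟩
  · intro D s hs hs0 hcy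
    have hz : (ζ ^ s) ^ n = 1 := by rw [← pow_mul, mul_comm, pow_mul, hζ.pow_eq_one, one_pow]
    have h1 := hζ.pow_ne_one_of_pos_of_lt hs0 hs
    obtain ⟨k, hk⟩ := (SelfDualNormal.cycloEquiv_iff hn.pos hζ _ hs).1 hcy
    rw [IntermediateField.adjoin.finrank (SelfDualNormal.isIntegral_of_pow_eq_one hn.pos hz)]
    exact ⟨(SelfDualNormal.even_natDegree_minpoly hn hz h1 hk).1, D.exists_factor hn hz h1 hk⟩
  · refine ⟨fun i => (D.f i).natDegree / 2, fun j => (D.g j).natDegree, fun i hi => ?_,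
      fun _ _ => rfl, fun E _ _ hE => ?_⟩
    · exact Nat.mul_div_cancel' (D.even_natDegree hn hF hi).two_dvd
    · have : NeZero (n : AlgebraicClosure F) :=
        ⟨by simpa using (map_ne_zero (algebraMap F (AlgebraicClosure F))).2 hF⟩
      obtain ⟨ζ, hζ⟩ := HasEnoughRootsOfUnity.exists_primitiveRoot (AlgebraicClosure F) n
      obtain ⟨u, hu0, hsymm, hsq, hcard⟩ :=
        SelfDualNormal.exists_norm_equation (AlgebraicClosure F) hn.pos hζ hE
      rw [hcard]
      exact D.card_solutions hn hF hζ u hu0 hsymm hsq
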